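/- For integers $s\ge 1$ let $\bar\zeta(s)=\sum_{n=1}^{\infty}\frac{(-1)^{n-1}}{n^{s}}$ be the alternating Riemann zeta value, put $\bar\zeta(0)=\tfrac12$, let $\zeta$ be the Riemann zeta function, and for integers $p\ge 1$, $n\ge 0$ let $H_n^{(p)}=\sum_{k=1}^{n}\frac1{k^{p}}$ (so $H_0^{(p)}=0$). Let $j\ge 1$ and $m\ge 0$ be integers. Then the double series defining the alternating double zeta value $$\zeta(\overline{2j},2m+1):=\sum_{n>k\ge 1}\frac{(-1)^n}{n^{2j}k^{2m+1}}=\sum_{n=1}^{\infty}\frac{H_{n-1}^{(2m+1)}}{n^{2j}}(-1)^n$$ converges absolutely, the two series are equal, and $$\zeta(\overline{2j},2m+1)=\frac12\,\bar\zeta(2m+2j+1)-\sum_{k=0}^{m}\binom{2j+2m-2k}{2j-1}\bar\zeta(2k)\,\bar\zeta(2m+2j+1-2k)+\sum_{l=0}^{j-1}\binom{2j+2m-2l}{2m}\bar\zeta(2l)\,\zeta(2m+2j+1-2l).$$ -/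

import Mathlib

/-- The generalized harmonic number `H_n^{(p)} = ∑_{k=1}^n 1 / k^p`, with `H_0^{(p)} = 0`. -/
noncomputable def genHarmonic (p n : ℕ) : ℂ :=
  ∑ k ∈ Finset.Icc 1 n, 1 / (k : ℂ) ^ p

/-- The alternating Riemann zeta value `∑_{n ≥ 1} (-1)^(n-1) / n^s` at an integer `s ≥ 1`
(the limit of the partial sums, so that `s = 1` is included), with the value `1/2` at `s = 0`.
The summation index below is `n - 1`. -/
noncomputable def altZeta (s : ℕ) : ℂ :=
  if s = 0 then 1 / 2
  else ∑'[SummationFilter.conditional ℕ] n : ℕ, (-1 : ℂ) ^ n / ((n : ℂ) + 1) ^ s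

/-- The general term `(-1)^n / (n^p k^q)` of the alternating double zeta value, indexed by the
pairs `(n, k)` of integers with `n > k ≥ 1`. -/
noncomputable def altDoubleZetaTerm (p q : ℕ) (x : {x : ℕ × ℕ // 1 ≤ x.2 ∧ x.2 < x.1}) : ℂ :=
  (-1 : ℂ) ^ x.1.1 / ((x.1.1 : ℂ) ^ p * (x.1.2 : ℂ) ^ q)

/-- The alternating double zeta value `∑_{n > k ≥ 1} (-1)^n / (n^p k^q)`. -/
noncomputable def altDoubleZeta (p q : ℕ) : ℂ :=
  ∑' x : {x : ℕ × ℕ // 1 ≤ x.2 ∧ x.2 < x.1}, altDoubleZetaTerm p q x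

/-! Put p = 2j, q = 2m+1. Sum (-1)^n / (n^p (k-n)^q) over k ≥ 1 and integers n ≠ 0, k, in two
orders.

For fixed k, partial fractions in n (`pow_mul_pow_eq_pfHalf`) give powers of 1/k times symmetric
sums of (-1)^n / n^s, which vanish for odd s and equal -2 ζ̄(s) for even s. Summing over k yields
the products of zeta values (`hasSum_kernelValue`). The excluded points n = 0 and n = k leave
corrections; these are the ζ̄(0) = 1/2 terms.

For fixed n = ±r, oddness of q makes the sum over k collapse to -H_{r-1} - H_r (`tendsto_shiftSum`),
whence -2 ζ(p̄, q) + ζ̄(p+q). Since this inner sum diverges for q = 1, 2/k^q is subtracted first,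
which removes exactly one partial fraction term. The exchange is dominated convergence, with the
bound `abs_shiftSum_le`. -/

open Filter Topology

/-! ### Partial fractions -/

/-- One half of the partial fraction expansion of `1 / (x ^ (p + 1) * y ^ (q + 1))`, written in
`t = 1 / (x + y)` and `u = 1 / x`. -/
def pfHalf {R : Type*} [CommRing R] (t u : R) (p q : ℕ) : R :=
  ∑ i ∈ Finset.range (p + 1), ((q + i).choose q : R) * t ^ (q + 1 + i) * u ^ (p - i + 1)

theorem pfHalf_zero_left {R : Type*} [CommRing R] (t u : R) (q : ℕ) :
    pfHalf t u 0 q = t ^ (q + 1) * u := by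
  simp [pfHalf]

theorem pfHalf_succ_zero {R : Type*} [CommRing R] (t u : R) (p : ℕ) :
    pfHalf t u (p + 1) 0 = t * (u ^ (p + 2) + pfHalf t u p 0) := by
  rw [pfHalf, Finset.sum_range_succ', mul_add, pfHalf, Finset.mul_sum, add_comm]
  congr 1
  · simp
  · refine Finset.sum_congr rfl fun i _ => ?_
    rw [Nat.add_sub_add_right]
    simp
    ring

theorem pfHalf_succ_succ {R : Type*} [CommRing R] (t u : R) (p q : ℕ) :
    pfHalf t u (p + 1) (q + 1) = t * (pfHalf t u p (q + 1) + pfHalf t u (p + 1) q) := by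
  rw [pfHalf, Finset.sum_range_succ', mul_add, pfHalf, pfHalf,
    Finset.sum_range_succ' _ (p + 1), mul_add, Finset.mul_sum, Finset.mul_sum, ← add_assoc,
    ← Finset.sum_add_distrib]
  congr 1
  · refine Finset.sum_congr rfl fun i _ => ?_
    rw [Nat.add_sub_add_right, show q + 1 + (i + 1) = (q + 1 + i) + 1 by ring,
      Nat.choose_succ_succ, show q + (i + 1) = q + 1 + i by ring]
    push_cast
    ring
  · simp
    ring

/-- Multiplying `h` by powers of u and v lowers one exponent at a time at the cost of a factor t.
The right side obeys the same recursion, by Pascal's rule. -/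
theorem pow_mul_pow_eq_pfHalf {R : Type*} [CommRing R] {t u v : R} (h : u * v = t * (u + v))
    (p q : ℕ) : u ^ (p + 1) * v ^ (q + 1) = pfHalf t u p q + pfHalf t v q p := by
  induction p generalizing q with
  | zero =>
    induction q with
    | zero => simp only [pfHalf_zero_left]; linear_combination h
    | succ q ih =>
      rw [pfHalf_succ_zero]
      rw [pfHalf_zero_left] at ih ⊢
      linear_combination v ^ (q + 1) * h + t * ih
  | succ p ihp =>
    induction q with
    | zero =>
      have ih := ihp 0
      rw [pfHalf_succ_zero]
      rw [pfHalf_zero_left] at ih ⊢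
      linear_combination u ^ (p + 1) * h + t * ih
    | succ q ihq =>
      rw [pfHalf_succ_succ, pfHalf_succ_succ]
      linear_combination u ^ (p + 1) * v ^ (q + 1) * h + t * ihq + t * ihp (q + 1)

theorem pfHalf_eq_sum {R : Type*} [CommRing R] (t u : R) (p q : ℕ) :
    pfHalf t u p q = ∑ a ∈ Finset.range (p + 1),
      ((p + q - a).choose q : R) * t ^ (p + q + 1 - a) * u ^ (a + 1) := by
  rw [pfHalf, ← Finset.sum_range_reflect]
  refine Finset.sum_congr rfl fun a ha => ?_
  have := Finset.mem_range.1 ha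
  rw [show q + (p + 1 - 1 - a) = p + q - a by omega,
    show q + 1 + (p + 1 - 1 - a) = p + q + 1 - a by omega,
    show p - (p + 1 - 1 - a) = a by omega]

theorem sum_range_choose_sub (p q : ℕ) :
    ∑ a ∈ Finset.range (p + 1), (p + q - a).choose q = (p + q + 1).choose (q + 1) := by
  induction p with
  | zero => simp
  | succ p ih =>
    rw [Finset.sum_range_succ', Nat.sub_zero, Nat.choose_succ_succ (p + 1 + q), add_comm,
      show p + 1 + q = p + q + 1 by ring, ← ih]
    congr 1
    exact Finset.sum_congr rfl fun a _ => by rw [Nat.add_sub_add_right]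

/-! ### Symmetric sums over the integers -/

/-- The symmetric partial sum `∑_{|n| ≤ N} f n`. -/
def symSum (f : ℤ → ℝ) (N : ℕ) : ℝ :=
  f 0 + ∑ r ∈ Finset.range N, (f (r + 1) + f (-(r + 1)))

theorem symSum_shift (f : ℤ → ℝ) (k : ℤ) (N : ℕ) :
    symSum (fun n => f (k + 1 - n)) N
      = symSum (fun n => f (k - n)) N + f (k + 1 + N) - f (k - N) := by
  induction N with
  | zero => simp [symSum]
  | succ N ih =>
    simp only [symSum, Finset.sum_range_succ] at ih ⊢
    push_cast
    rw [show k + 1 - (N + 1 : ℤ) = k - N by ring, show k + 1 - -(N + 1 : ℤ) = k + 1 + (N + 1) by ring,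
      show k - -(N + 1 : ℤ) = k + 1 + N by ring]
    linear_combination ih

theorem symSum_neg (f : ℤ → ℝ) (N : ℕ) : symSum (fun n => f (-n)) N = symSum f N := by
  simp only [symSum, neg_zero, neg_neg]
  congr 1
  exact Finset.sum_congr rfl fun r _ => add_comm _ _

/-- The sum may converge only conditionally, so invariance under n ↦ k - n is not automatic: each
unit shift of the window changes two end terms, and these tend to 0. -/
theorem tendsto_symSum_sub {f : ℤ → ℝ} {L : ℝ} (h0 : Tendsto f cofinite (𝓝 0))
    (h : Tendsto (symSum f) atTop (𝓝 L)) (k : ℕ) :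
    Tendsto (symSum fun n => f (k - n)) atTop (𝓝 L) := by
  induction k with
  | zero => simpa using h.congr fun N => (symSum_neg f N).symm
  | succ k ih =>
    have h1 : Tendsto (fun N : ℕ => f ((k : ℤ) + 1 + N)) atTop (𝓝 0) := by
      rw [← Nat.cofinite_eq_atTop]
      exact h0.comp (Function.Injective.tendsto_cofinite fun a b hab => by
        simpa using hab)
    have h2 : Tendsto (fun N : ℕ => f ((k : ℤ) - N)) atTop (𝓝 0) := by
      rw [← Nat.cofinite_eq_atTop]
      exact h0.comp (Function.Injective.tendsto_cofinite fun a b hab => by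
        simpa using hab)
    have h3 := (ih.add h1).sub h2
    simp only [add_zero, sub_zero] at h3
    refine h3.congr fun N => ?_
    rw [← symSum_shift]
    push_cast
    rfl

theorem symSum_add (f g : ℤ → ℝ) (N : ℕ) :
    symSum (fun n => f n + g n) N = symSum f N + symSum g N := by
  simp only [symSum, Finset.sum_add_distrib]; ring

theorem symSum_mul (c : ℝ) (f : ℤ → ℝ) (N : ℕ) :
    symSum (fun n => c * f n) N = c * symSum f N := by
  simp only [symSum, mul_add, Finset.mul_sum]

theorem symSum_sum {ι : Type*} (s : Finset ι) (f : ι → ℤ → ℝ) (N : ℕ) :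
    symSum (fun n => ∑ i ∈ s, f i n) N = ∑ i ∈ s, symSum (f i) N := by
  classical
  induction s using Finset.induction_on with
  | empty => simp [symSum]
  | insert a s ha ih => simp only [Finset.sum_insert ha, symSum_add, ih]

/-! ### Symmetric alternating sums -/

/-- The real alternating zeta value as an unconditional sum. -/
noncomputable def altZetaReal (s : ℕ) : ℝ := ∑' n : ℕ, (-1 : ℝ) ^ n / ((n : ℝ) + 1) ^ s

/-- The real zeta value. -/
noncomputable def zetaReal (s : ℕ) : ℝ := ∑' n : ℕ, 1 / ((n : ℝ) + 1) ^ s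

theorem hasSum_zetaReal {s : ℕ} (hs : 2 ≤ s) :
    HasSum (fun n : ℕ => 1 / ((n : ℝ) + 1) ^ s) (zetaReal s) := by
  refine Summable.hasSum ?_
  have := (summable_nat_add_iff 1).2 (Real.summable_one_div_nat_pow.2 (by omega : 1 < s))
  simpa using this

theorem hasSum_altZetaReal {s : ℕ} (hs : 2 ≤ s) :
    HasSum (fun n : ℕ => (-1 : ℝ) ^ n / ((n : ℝ) + 1) ^ s) (altZetaReal s) := by
  refine Summable.hasSum (Summable.of_norm ?_)
  refine (hasSum_zetaReal hs).summable.congr fun n => ?_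
  rw [norm_div, norm_pow, norm_pow, norm_neg, norm_one, one_pow, Real.norm_of_nonneg (by positivity)]

/-- The limit of `∑_{0 < |n| ≤ N} (-1)^n / n^s`. -/
noncomputable def symAltZeta (s : ℕ) : ℝ := if Even s then -2 * altZetaReal s else 0

theorem tendsto_symSum_alt {s : ℕ} (hs : 1 ≤ s) :
    Tendsto (symSum fun n => (-1 : ℝ) ^ n * ((n : ℝ)⁻¹) ^ s) atTop (𝓝 (symAltZeta s)) := by
  have key : HasSum (fun r : ℕ => (-1 : ℝ) ^ ((r : ℤ) + 1) * ((((r : ℤ) + 1 : ℤ) : ℝ)⁻¹) ^ s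
      + (-1 : ℝ) ^ (-((r : ℤ) + 1)) * (((-((r : ℤ) + 1) : ℤ) : ℝ)⁻¹) ^ s) (symAltZeta s) := by
    have hn : ∀ r : ℕ, (-1 : ℝ) ^ (-((r : ℤ) + 1)) = (-1 : ℝ) ^ ((r : ℤ) + 1) := fun r => by
      rw [zpow_neg, ← inv_zpow, inv_neg, inv_one]
    have hp : ∀ r : ℕ, (-1 : ℝ) ^ ((r : ℤ) + 1) = -(-1) ^ r := fun r => by
      rw [zpow_add₀ (by norm_num)]; simp
    rcases Nat.even_or_odd s with he | ho
    · rw [symAltZeta, if_pos he]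
      have h2 : 2 ≤ s := by obtain ⟨c, rfl⟩ := he; omega
      refine ((hasSum_altZetaReal h2).mul_left (-2)).congr_fun ?_ 
      intro r
      rw [hn, hp]
      push_cast
      rw [inv_neg, he.neg_pow, inv_pow]
      ring
    · rw [symAltZeta, if_neg (Nat.not_even_iff_odd.2 ho)]
      refine hasSum_zero.congr_fun ?_
      intro r
      rw [hn, hp]
      push_cast
      rw [inv_neg, ho.neg_pow]
      ring
  refine key.tendsto_sum_nat.congr fun N => ?_
  -- The term n = 0 vanishes since `0⁻¹ = 0` and `s ≠ 0`.
  simp [symSum, zero_pow (by omega : s ≠ 0)]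

theorem tendsto_alt_cofinite {s : ℕ} (hs : 1 ≤ s) :
    Tendsto (fun n : ℤ => (-1 : ℝ) ^ n * ((n : ℝ)⁻¹) ^ s) cofinite (𝓝 0) := by
  have h1 : Tendsto (fun n : ℤ => (|(n : ℝ)|⁻¹) ^ s) cofinite (𝓝 0) := by
    have h2 : Tendsto (fun n : ℤ => |(n : ℝ)|) cofinite atTop := by
      have := tendsto_norm_cocompact_atTop.comp Int.tendsto_coe_cofinite
      exact this
    simpa [zero_pow (by omega : s ≠ 0)] using (tendsto_inv_atTop_zero.comp h2).pow s
  refine squeeze_zero_norm (fun n => ?_) h1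
  simp

theorem tendsto_symSum_delta :
    Tendsto (symSum fun n => if n = 0 then (1 : ℝ) else 0) atTop (𝓝 1) := by
  refine tendsto_const_nhds.congr fun N => ?_
  rw [symSum, Finset.sum_eq_zero, if_pos rfl, add_zero]
  intro r _
  rw [if_neg (by omega), if_neg (by omega), add_zero]

theorem tendsto_delta_cofinite :
    Tendsto (fun n : ℤ => if n = 0 then (1 : ℝ) else 0) cofinite (𝓝 0) := by
  refine tendsto_const_nhds.congr' ?_
  rw [EventuallyEq, Filter.eventually_cofinite]
  refine (Set.finite_singleton (0 : ℤ)).subset fun n hn => ?_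
  by_contra h
  exact hn (if_neg (by simpa using h)).symm

/-! ### The kernel summed over n -/

theorem pfHalf_zero_right {R : Type*} [CommRing R] (t : R) (p q : ℕ) : pfHalf t 0 p q = 0 := by
  simp [pfHalf]

/-- This is the value left over at n = 0 and n = k, where one of the inverses of n and k - n is 0 by
convention and the other equals 1/k. -/
theorem pfHalf_self {R : Type*} [CommRing R] (t : R) (p q : ℕ) :
    pfHalf t t p q = ((p + q + 1).choose (q + 1) : R) * t ^ (p + q + 2) := by
  rw [pfHalf_eq_sum, ← sum_range_choose_sub, Nat.cast_sum, Finset.sum_mul]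
  refine Finset.sum_congr rfl fun a ha => ?_
  have := Finset.mem_range.1 ha
  rw [mul_assoc, ← pow_add, show p + q + 1 - a + (a + 1) = p + q + 2 by omega]

/-- The term `(-1)^n / (n^(p+1) (k-n)^(q+1))`, which is `0` for `n = 0` and for `n = k`. -/
noncomputable def kernelTerm (p q k : ℕ) (n : ℤ) : ℝ :=
  (-1 : ℝ) ^ n * (((n : ℝ)⁻¹) ^ (p + 1) * ((((k : ℤ) - n : ℤ) : ℝ)⁻¹) ^ (q + 1))

theorem neg_one_zpow_eq_mul_sub (k n : ℤ) : (-1 : ℝ) ^ n = (-1 : ℝ) ^ k * (-1 : ℝ) ^ (k - n) := by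
  rw [← zpow_add₀ (by norm_num), show k + (k - n) = 2 * k - n by ring, zpow_sub₀ (by norm_num),
    zpow_mul]
  rcases Int.even_or_odd n with h | h <;> simp [h.neg_one_zpow]

/-- At n = 0 and n = k the left side is 0 but one half of the expansion survives; the two indicator
terms cancel it. -/
theorem kernelTerm_eq (p q : ℕ) {k : ℕ} (hk : 1 ≤ k) (n : ℤ) :
    kernelTerm p q k n =
      (-1 : ℝ) ^ n * pfHalf (k : ℝ)⁻¹ (n : ℝ)⁻¹ p q
      + (-1 : ℝ) ^ k * ((-1 : ℝ) ^ ((k : ℤ) - n)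
          * pfHalf (k : ℝ)⁻¹ (((k : ℤ) - n : ℤ) : ℝ)⁻¹ q p)
      + (-(((p + q + 1).choose (p + 1) : ℝ) * (k : ℝ)⁻¹ ^ (p + q + 2))
          * (if n = 0 then (1 : ℝ) else 0)
      + -((-1) ^ k * ((p + q + 1).choose (q + 1) : ℝ) * (k : ℝ)⁻¹ ^ (p + q + 2))
          * (if (k : ℤ) - n = 0 then (1 : ℝ) else 0)) := by
  have e := neg_one_zpow_eq_mul_sub k n
  rw [zpow_natCast] at e
  rw [← mul_assoc ((-1 : ℝ) ^ k), ← e, kernelTerm]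
  have hk0 : (k : ℤ) ≠ 0 := by omega
  have hc : q + p + 1 = p + q + 1 := by ring
  have hc2 : q + p + 2 = p + q + 2 := by ring
  by_cases h0 : n = 0
  · subst h0
    simp [pfHalf_zero_right, pfHalf_self, hc, hc2]
    omega
  · by_cases h1 : (k : ℤ) - n = 0
    · have h1' : n = k := by omega
      subst h1'
      simp [pfHalf_zero_right, pfHalf_self]
      rw [if_neg (by omega)]
      ring
    · rw [if_neg h0, if_neg h1, pow_mul_pow_eq_pfHalf (t := (k : ℝ)⁻¹)]
      · ring
      · have a1 : (n : ℝ) ≠ 0 := by exact_mod_cast h0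
        have a2 : (((k : ℤ) - n : ℤ) : ℝ) ≠ 0 := by exact_mod_cast h1
        have a3 : (k : ℝ) ≠ 0 := by exact_mod_cast hk0
        field_simp
        push_cast
        ring

/-- The contribution of one half of the partial fraction expansion. -/
noncomputable def altHalf (t : ℝ) (p q : ℕ) : ℝ :=
  ∑ a ∈ Finset.range (p + 1),
    ((p + q - a).choose q : ℝ) * t ^ (p + q + 1 - a) * symAltZeta (a + 1)

theorem alt_mul_pfHalf (t : ℝ) (p q : ℕ) (n : ℤ) :
    (-1 : ℝ) ^ n * pfHalf t (n : ℝ)⁻¹ p q = ∑ a ∈ Finset.range (p + 1),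
      ((p + q - a).choose q : ℝ) * t ^ (p + q + 1 - a) *
        ((-1 : ℝ) ^ n * ((n : ℝ)⁻¹) ^ (a + 1)) := by
  rw [pfHalf_eq_sum, Finset.mul_sum]
  exact Finset.sum_congr rfl fun a _ => by ring

theorem tendsto_symSum_pfHalf (t : ℝ) (p q : ℕ) :
    Tendsto (symSum fun n => (-1 : ℝ) ^ n * pfHalf t (n : ℝ)⁻¹ p q) atTop
      (𝓝 (altHalf t p q)) := by
  have h := tendsto_finsetSum (Finset.range (p + 1)) fun a _ =>
    (tendsto_symSum_alt (s := a + 1) (by omega)).const_mul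
      (((p + q - a).choose q : ℝ) * t ^ (p + q + 1 - a))
  refine h.congr fun N => ?_
  simp only [alt_mul_pfHalf]
  rw [symSum_sum]
  simp only [symSum_mul]

theorem tendsto_pfHalf_cofinite (t : ℝ) (p q : ℕ) :
    Tendsto (fun n : ℤ => (-1 : ℝ) ^ n * pfHalf t (n : ℝ)⁻¹ p q) cofinite (𝓝 0) := by
  have h := tendsto_finsetSum (Finset.range (p + 1)) fun a _ =>
    (tendsto_alt_cofinite (s := a + 1) (by omega)).const_mul
      (((p + q - a).choose q : ℝ) * t ^ (p + q + 1 - a))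
  simp only [alt_mul_pfHalf]
  simpa using h

theorem tendsto_symSum_kernelTerm (p q : ℕ) {k : ℕ} (hk : 1 ≤ k) :
    Tendsto (symSum (kernelTerm p q k)) atTop
      (𝓝 (altHalf (k : ℝ)⁻¹ p q + (-1 : ℝ) ^ k * altHalf (k : ℝ)⁻¹ q p
        - ((p + q + 1).choose (p + 1) : ℝ) * (k : ℝ)⁻¹ ^ (p + q + 2)
        - (-1) ^ k * ((p + q + 1).choose (q + 1) : ℝ) * (k : ℝ)⁻¹ ^ (p + q + 2))) := by
  have h1 := tendsto_symSum_pfHalf (k : ℝ)⁻¹ p q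
  have h2 := (tendsto_symSum_sub (tendsto_pfHalf_cofinite (k : ℝ)⁻¹ q p)
    (tendsto_symSum_pfHalf (k : ℝ)⁻¹ q p) k).const_mul ((-1 : ℝ) ^ k)
  have h3 := tendsto_symSum_delta.const_mul
    (-(((p + q + 1).choose (p + 1) : ℝ) * (k : ℝ)⁻¹ ^ (p + q + 2)))
  have h4 := (tendsto_symSum_sub tendsto_delta_cofinite tendsto_symSum_delta k).const_mul
    (-((-1) ^ k * ((p + q + 1).choose (q + 1) : ℝ) * (k : ℝ)⁻¹ ^ (p + q + 2)))
  have h := (h1.add h2).add (h3.add h4)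
  rw [mul_one, mul_one, ← add_assoc, ← sub_eq_add_neg, ← sub_eq_add_neg] at h
  refine h.congr fun N => ?_
  rw [← symSum_mul, ← symSum_mul, ← symSum_mul, ← symSum_add, ← symSum_add, ← symSum_add]
  congr 1
  funext n
  rw [kernelTerm_eq p q hk]

theorem norm_kernelTerm_le (p q k : ℕ) (n : ℤ) :
    ‖kernelTerm p q k n‖ ≤ (|(n : ℝ)|⁻¹) ^ (p + 1) := by
  rw [kernelTerm, norm_mul, norm_mul, norm_zpow, norm_neg, norm_one, one_zpow, one_mul, norm_pow,
    norm_pow, norm_inv, norm_inv, Real.norm_eq_abs]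
  refine mul_le_of_le_one_right (by positivity) (pow_le_one₀ (by positivity) ?_)
  rcases eq_or_ne ((k : ℤ) - n) 0 with h | h
  · simp [h]
  · refine inv_le_one_of_one_le₀ ?_
    rw [Real.norm_eq_abs, ← Int.cast_abs]
    exact_mod_cast Int.one_le_abs h

theorem hasSum_kernelTerm {p : ℕ} (hp : 1 ≤ p) (q : ℕ) {k : ℕ} (hk : 1 ≤ k) :
    HasSum (fun r : ℕ => kernelTerm p q k (r + 1) + kernelTerm p q k (-(r + 1)))
      (altHalf (k : ℝ)⁻¹ p q + (-1 : ℝ) ^ k * altHalf (k : ℝ)⁻¹ q p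
        - ((p + q + 1).choose (p + 1) : ℝ) * (k : ℝ)⁻¹ ^ (p + q + 2)
        - (-1) ^ k * ((p + q + 1).choose (q + 1) : ℝ) * (k : ℝ)⁻¹ ^ (p + q + 2)) := by
  have hz := (hasSum_zetaReal (s := p + 1) (by omega)).summable
  have hb : ∀ r : ℕ, (|(((r : ℤ) + 1 : ℤ) : ℝ)|⁻¹) ^ (p + 1) = 1 / ((r : ℝ) + 1) ^ (p + 1) := by
    intro r
    push_cast
    rw [abs_of_nonneg (by positivity), inv_pow, one_div]
  have hs : Summable (fun r : ℕ => kernelTerm p q k (r + 1) + kernelTerm p q k (-(r + 1))) := by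
    refine Summable.add (Summable.of_norm_bounded hz fun r => ?_)
      (Summable.of_norm_bounded hz fun r => ?_)
    · rw [← hb]; exact norm_kernelTerm_le _ _ _ _
    · rw [← hb]
      refine (norm_kernelTerm_le _ _ _ _).trans_eq ?_
      rw [Int.cast_neg, abs_neg]
  rw [← tendsto_nhds_unique ((hs.hasSum.tendsto_sum_nat).congr fun N => ?_)
    (tendsto_symSum_kernelTerm p q hk)]
  · exact hs.hasSum
  · simp [symSum, kernelTerm]

/-! ### Harmonic numbers and the sum over k -/

/-- The real generalized harmonic number. -/
noncomputable def realHarmonic (q n : ℕ) : ℝ := ∑ i ∈ Finset.range n, 1 / ((i : ℝ) + 1) ^ q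

theorem realHarmonic_zero (q : ℕ) : realHarmonic q 0 = 0 := by simp [realHarmonic]

theorem realHarmonic_succ (q n : ℕ) :
    realHarmonic q (n + 1) = realHarmonic q n + 1 / ((n : ℝ) + 1) ^ q := by
  simp [realHarmonic, Finset.sum_range_succ]

theorem realHarmonic_nonneg (q n : ℕ) : 0 ≤ realHarmonic q n :=
  Finset.sum_nonneg fun _ _ => by positivity

theorem realHarmonic_add (q a b : ℕ) : realHarmonic q (a + b) =
    realHarmonic q a + ∑ i ∈ Finset.range b, 1 / (((a + i : ℕ) : ℝ) + 1) ^ q :=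
  Finset.sum_range_add _ _ _

theorem realHarmonic_mono (q : ℕ) : Monotone (realHarmonic q) :=
  monotone_nat_of_le_succ fun n => by
    rw [realHarmonic_succ]
    have : (0 : ℝ) ≤ 1 / ((n : ℝ) + 1) ^ q := by positivity
    linarith

theorem realHarmonic_add_le (q a b : ℕ) :
    realHarmonic q (a + b) ≤ realHarmonic q a + realHarmonic q b := by
  rw [realHarmonic_add, realHarmonic.eq_1 q b]
  gcongr with i _
  omega

theorem tendsto_realHarmonic_add_sub {q : ℕ} (hq : 1 ≤ q) (s : ℕ) :
    Tendsto (fun K => realHarmonic q (K + s) - realHarmonic q K) atTop (𝓝 0) := by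
  have h : ∀ i ∈ Finset.range s,
      Tendsto (fun K : ℕ => 1 / (((K + i : ℕ) : ℝ) + 1) ^ q) atTop (𝓝 0) := fun i _ => by
    have h1 : Tendsto (fun K : ℕ => ((K + i : ℕ) : ℝ) + 1) atTop atTop :=
      tendsto_atTop_add_const_right _ _
        (tendsto_natCast_atTop_atTop.comp (tendsto_add_atTop_nat i))
    have h2 := ((tendsto_pow_atTop (by omega : q ≠ 0)).comp h1).inv_tendsto_atTop
    refine h2.congr fun K => ?_
    simp
  have := tendsto_finsetSum _ h
  rw [Finset.sum_const_zero] at this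
  refine this.congr fun K => ?_
  rw [realHarmonic_add]
  ring

/-- Terms with i < r are negative because q is odd, i = r gives 0, and i > r gives positive terms;
truncated subtraction covers all ranges of K at once. -/
theorem sum_inv_sub_pow {q : ℕ} (hq : Odd q) (r K : ℕ) :
    ∑ i ∈ Finset.range K, (((i : ℝ) + 1 - (r + 1))⁻¹) ^ q =
      realHarmonic q (K - (r + 1)) + realHarmonic q (r - K) - realHarmonic q r := by
  have hq0 : q ≠ 0 := by rintro rfl; exact absurd hq (by decide)
  induction K with
  | zero => simp [realHarmonic_zero]
  | succ K ih =>
    rw [Finset.sum_range_succ, ih]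
    rcases lt_trichotomy K r with h | rfl | h
    · obtain ⟨d, rfl⟩ := Nat.exists_eq_add_of_lt h
      rw [show K + 1 - (K + d + 1 + 1) = 0 by omega, show K - (K + d + 1 + 1) = 0 by omega,
        show K + d + 1 - K = d + 1 by omega, show K + d + 1 - (K + 1) = d by omega,
        realHarmonic_succ, show ((K : ℝ) + 1 - (((K + d + 1 : ℕ) : ℝ) + 1)) = -((d : ℝ) + 1) by
          push_cast; ring, inv_neg, hq.neg_pow, inv_pow]
      ring
    · simp [zero_pow hq0]
    · obtain ⟨d, rfl⟩ := Nat.exists_eq_add_of_lt h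
      rw [show r + d + 1 + 1 - (r + 1) = d + 1 by omega, show r + d + 1 - (r + 1) = d by omega,
        show r - (r + d + 1) = 0 by omega, show r - (r + d + 1 + 1) = 0 by omega,
        realHarmonic_succ, show (((r + d + 1 : ℕ) : ℝ) + 1 - ((r : ℝ) + 1)) = (d : ℝ) + 1 by
          push_cast; ring, inv_pow]
      ring

theorem sum_inv_add_pow (q r K : ℕ) :
    ∑ i ∈ Finset.range K, (((i : ℝ) + 1 + (r + 1))⁻¹) ^ q =
      realHarmonic q (K + (r + 1)) - realHarmonic q (r + 1) := by
  rw [add_comm K, realHarmonic_add, add_sub_cancel_left]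
  refine Finset.sum_congr rfl fun i _ => ?_
  rw [inv_pow, one_div]
  push_cast
  ring

/-- `∑_{k ≤ K} (1/(k-(r+1))^q + 1/(k+(r+1))^q - 2/k^q)`. -/
noncomputable def shiftSum (q r K : ℕ) : ℝ :=
  ∑ i ∈ Finset.range K, ((((i : ℝ) + 1 - (r + 1))⁻¹) ^ q + (((i : ℝ) + 1 + (r + 1))⁻¹) ^ q
    - 2 * (((i : ℝ) + 1)⁻¹) ^ q)

theorem shiftSum_eq {q : ℕ} (hq : Odd q) (r K : ℕ) : shiftSum q r K =
    realHarmonic q (K - (r + 1)) + realHarmonic q (r - K) - realHarmonic q r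
    + (realHarmonic q (K + (r + 1)) - realHarmonic q (r + 1)) - 2 * realHarmonic q K := by
  rw [shiftSum, Finset.sum_sub_distrib, Finset.sum_add_distrib, sum_inv_sub_pow hq,
    sum_inv_add_pow, ← Finset.mul_sum]
  simp [realHarmonic]

/-- The bound is uniform in K, as domination requires; it rests on the subadditivity of the harmonic
numbers. -/
theorem abs_shiftSum_le {q : ℕ} (hq : Odd q) (r K : ℕ) :
    |shiftSum q r K| ≤ 3 * realHarmonic q (r + 1) := by
  rw [shiftSum_eq hq, abs_le]
  have h1 := realHarmonic_add_le q K (r + 1)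
  have h2 := realHarmonic_mono q (Nat.le_add_right K (r + 1))
  have h3 := realHarmonic_mono q (Nat.sub_le K (r + 1))
  have h4 : realHarmonic q K ≤ realHarmonic q (K - (r + 1)) + realHarmonic q (r + 1) :=
    (realHarmonic_mono q (by omega)).trans (realHarmonic_add_le q _ _)
  have h5 := realHarmonic_mono q (Nat.sub_le r K)
  have h6 := realHarmonic_mono q (Nat.le_succ r)
  have h7 := realHarmonic_nonneg q (r - K)
  have h8 := realHarmonic_nonneg q r
  constructor <;> linarith

theorem tendsto_shiftSum {q : ℕ} (hq : Odd q) (r : ℕ) :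
    Tendsto (shiftSum q r) atTop (𝓝 (-realHarmonic q r - realHarmonic q (r + 1))) := by
  have hq1 : 1 ≤ q := hq.pos
  have h1 := tendsto_realHarmonic_add_sub hq1 (r + 1)
  have h2 := h1.comp (tendsto_sub_atTop_nat (r + 1))
  have h := (h1.sub h2).add_const (-realHarmonic q r - realHarmonic q (r + 1))
  rw [sub_zero, zero_add] at h
  refine h.congr' ?_
  filter_upwards [eventually_ge_atTop (r + 1)] with K hK
  rw [shiftSum_eq hq, Function.comp_apply, Nat.sub_add_cancel hK, show r - K = 0 by omega,
    realHarmonic_zero]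
  ring

/-! ### The double series and the passage from complex to real values -/

theorem genHarmonic_eq (q n : ℕ) : genHarmonic q n = (realHarmonic q n : ℂ) := by
  induction n with
  | zero => simp [genHarmonic, realHarmonic]
  | succ n ih =>
    rw [genHarmonic] at ih ⊢
    rw [Finset.sum_Icc_succ_top (by omega), ih, realHarmonic_succ]
    push_cast
    rfl

theorem summable_one_div_mul_sqrt : Summable fun n : ℕ => 1 / ((n : ℝ) * √n) := by
  refine (Real.summable_one_div_nat_rpow.2 (by norm_num : (1 : ℝ) < 3 / 2)).congr fun n => ?_
  rcases Nat.eq_zero_or_pos n with rfl | hn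
  · simp
  · rw [Real.sqrt_eq_rpow, ← Real.rpow_one_add' (by positivity) (by norm_num)]
    norm_num

/-- Since k < n, n² k ≥ (n√n)(k√k), so a product of two convergent series dominates even when q = 1.
-/
theorem summable_altDoubleZetaTerm {p q : ℕ} (hp : 2 ≤ p) (hq : 1 ≤ q) :
    Summable (altDoubleZetaTerm p q) := by
  have h := summable_one_div_mul_sqrt.mul_of_nonneg summable_one_div_mul_sqrt
    (fun n => by positivity) (fun n => by positivity)
  refine Summable.of_norm_bounded
    (h.comp_injective (i := Subtype.val (p := fun x : ℕ × ℕ => 1 ≤ x.2 ∧ x.2 < x.1))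
      Subtype.val_injective) ?_
  rintro ⟨⟨n, k⟩, hk : 1 ≤ k, hkn : k < n⟩
  rw [altDoubleZetaTerm]
  simp only [Function.comp_apply, norm_div, norm_pow, norm_mul, norm_neg, norm_one, one_pow,
    Complex.norm_natCast]
  rw [div_mul_div_comm, one_mul]
  have k1 : (1 : ℝ) ≤ k := by exact_mod_cast hk
  have kn : (k : ℝ) ≤ n := by exact_mod_cast hkn.le
  have n1 : (1 : ℝ) ≤ n := k1.trans kn
  have hs := Real.sqrt_le_sqrt kn
  have hn := Real.mul_self_sqrt (by linarith : (0 : ℝ) ≤ n)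
  have hpos : 0 < √(k : ℝ) := Real.sqrt_pos.2 (by linarith)
  have hpos' : 0 < √(n : ℝ) := Real.sqrt_pos.2 (by linarith)
  refine one_div_le_one_div_of_le (by positivity) ?_
  calc (n : ℝ) * √n * (k * √k) = n * k * (√n * √k) := by ring
    _ ≤ n * k * (√n * √n) := by gcongr
    _ = n ^ 2 * k ^ 1 := by rw [hn]; ring
    _ ≤ n ^ p * k ^ q := by gcongr

/-- The pairs `(n, k)` with `n > k ≥ 1`, grouped by `n`. -/
def doubleIndexEquiv : (Σ n : ℕ, Fin n) ≃ {x : ℕ × ℕ // 1 ≤ x.2 ∧ x.2 < x.1} where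
  toFun x := ⟨(x.1 + 1, x.2 + 1), by have := x.2.2; dsimp; omega⟩
  invFun x := ⟨x.1.1 - 1, ⟨x.1.2 - 1, by have := x.2; omega⟩⟩
  left_inv x := by simp
  right_inv x := by
    obtain ⟨⟨n, k⟩, hk⟩ := x
    simp only at hk
    simp only [Subtype.mk.injEq, Prod.mk.injEq]
    omega

theorem hasSum_altDoubleZeta {p q : ℕ} (hp : 2 ≤ p) (hq : 1 ≤ q) :
    HasSum (fun n : ℕ => genHarmonic q n / ((n : ℂ) + 1) ^ p * (-1 : ℂ) ^ (n + 1))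
      (altDoubleZeta p q) := by
  have h := doubleIndexEquiv.hasSum_iff.2 (summable_altDoubleZetaTerm hp hq).hasSum
  refine (h.sigma fun n => hasSum_fintype _).congr_fun fun n => ?_
  rw [genHarmonic_eq, realHarmonic, ← Fin.sum_univ_eq_sum_range (fun i => 1 / ((i : ℝ) + 1) ^ q)]
  push_cast
  rw [Finset.sum_div, Finset.sum_mul]
  refine Finset.sum_congr rfl fun i _ => ?_
  simp only [Function.comp_apply, doubleIndexEquiv, Equiv.coe_fn_mk, altDoubleZetaTerm]
  push_cast
  field_simp

theorem summable_realHarmonic_div {p q : ℕ} (hp : 2 ≤ p) (hq : 1 ≤ q) :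
    Summable fun n : ℕ => realHarmonic q n / ((n : ℝ) + 1) ^ p := by
  refine (hasSum_altDoubleZeta hp hq).summable.norm.congr fun n => ?_
  rw [genHarmonic_eq, norm_mul, norm_div, norm_pow, norm_pow, norm_neg, norm_one, one_pow, mul_one,
    Complex.norm_real, Real.norm_of_nonneg (realHarmonic_nonneg _ _)]
  congr 2
  exact_mod_cast Complex.norm_natCast (n + 1)

theorem summable_realHarmonic_succ_div {p q : ℕ} (hp : 2 ≤ p) (hq : 1 ≤ q) :
    Summable fun n : ℕ => realHarmonic q (n + 1) / ((n : ℝ) + 1) ^ p := by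
  refine ((summable_realHarmonic_div hp hq).add
    (hasSum_zetaReal (s := q + p) (by omega)).summable).congr fun n => ?_
  rw [realHarmonic_succ, add_div, pow_add, div_div]

/-- The real alternating double zeta value. -/
noncomputable def altDoubleZetaReal (p q : ℕ) : ℝ :=
  ∑' n : ℕ, (-1 : ℝ) ^ (n + 1) * (realHarmonic q n / ((n : ℝ) + 1) ^ p)

theorem hasSum_altDoubleZetaReal {p q : ℕ} (hp : 2 ≤ p) (hq : 1 ≤ q) :
    HasSum (fun n : ℕ => (-1 : ℝ) ^ (n + 1) * (realHarmonic q n / ((n : ℝ) + 1) ^ p))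
      (altDoubleZetaReal p q) := by
  refine Summable.hasSum (Summable.of_norm ((summable_realHarmonic_div hp hq).congr fun n => ?_))
  rw [norm_mul, norm_pow, norm_neg, norm_one, one_pow, one_mul,
    Real.norm_of_nonneg (div_nonneg (realHarmonic_nonneg _ _) (by positivity))]

theorem altDoubleZeta_eq_ofReal {p q : ℕ} (hp : 2 ≤ p) (hq : 1 ≤ q) :
    altDoubleZeta p q = (altDoubleZetaReal p q : ℂ) := by
  refine (hasSum_altDoubleZeta hp hq).unique ?_
  refine (Complex.hasSum_ofReal.2 (hasSum_altDoubleZetaReal hp hq)).congr_fun fun n => ?_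
  rw [genHarmonic_eq]
  push_cast
  ring

theorem altZeta_eq_ofReal {s : ℕ} (hs : 2 ≤ s) : altZeta s = (altZetaReal s : ℂ) := by
  have h := Complex.hasSum_ofReal.2 (hasSum_altZetaReal hs)
  rw [altZeta, if_neg (by omega), ← h.tsum_eq, tsum_eq_of_summable_unconditional]
  · push_cast; rfl
  · refine h.summable.congr fun n => ?_
    push_cast; rfl

theorem riemannZeta_eq_ofReal {s : ℕ} (hs : 2 ≤ s) : riemannZeta s = (zetaReal s : ℂ) := by
  rw [zeta_nat_eq_tsum_of_gt_one (by omega), zetaReal, Complex.ofReal_tsum,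
    Summable.tsum_eq_zero_add]
  · rw [Nat.cast_zero, zero_pow (by omega), div_zero, zero_add]
    push_cast; rfl
  · refine (Complex.summable_ofReal.2
      (Real.summable_one_div_nat_pow.2 (by omega : 1 < s))).congr fun n => ?_
    push_cast; rfl

theorem hasSum_inv_pow {s : ℕ} (hs : 2 ≤ s) :
    HasSum (fun i : ℕ => (((i + 1 : ℕ) : ℝ)⁻¹) ^ s) (zetaReal s) :=
  (hasSum_zetaReal hs).congr_fun fun i => by rw [inv_pow, one_div]; push_cast; rfl

theorem hasSum_alt_inv_pow {s : ℕ} (hs : 2 ≤ s) :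
    HasSum (fun i : ℕ => (-1 : ℝ) ^ (i + 1) * (((i + 1 : ℕ) : ℝ)⁻¹) ^ s) (-altZetaReal s) :=
  (hasSum_altZetaReal hs).neg.congr_fun fun i => by rw [inv_pow]; push_cast; ring

/-! ### Exchange of the two summations -/

/-- The value of `kernelTerm` summed over `n`, less the part that grows with `k`. -/
noncomputable def kernelValue (P Q k : ℕ) : ℝ :=
  ∑ a ∈ Finset.range P,
    ((P + Q - a).choose Q : ℝ) * (k : ℝ)⁻¹ ^ (P + Q + 1 - a) * symAltZeta (a + 1)
  + (-1 : ℝ) ^ k * altHalf (k : ℝ)⁻¹ Q P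
  - ((P + Q + 1).choose (P + 1) : ℝ) * (k : ℝ)⁻¹ ^ (P + Q + 2)
  - (-1) ^ k * ((P + Q + 1).choose (Q + 1) : ℝ) * (k : ℝ)⁻¹ ^ (P + Q + 2)

theorem hasSum_kernel_sub {P : ℕ} (hP : Odd P) (Q i : ℕ) :
    HasSum (fun r : ℕ => (-1 : ℝ) ^ (r + 1) / ((r : ℝ) + 1) ^ (P + 1) *
        ((((i : ℝ) + 1 - (r + 1))⁻¹) ^ (Q + 1) + (((i : ℝ) + 1 + (r + 1))⁻¹) ^ (Q + 1)
          - 2 * (((i : ℝ) + 1)⁻¹) ^ (Q + 1)))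
      (kernelValue P Q (i + 1)) := by
  have hP1 : 1 ≤ P := hP.pos
  have h1 := hasSum_kernelTerm hP1 Q (k := i + 1) (by omega)
  -- The subtracted 2/k^(Q+1) contributes this series; it cancels the a = P term of `altHalf`, which
  -- would diverge over k when Q = 0.
  have h2 := (hasSum_altZetaReal (s := P + 1) (by omega)).mul_left
    (2 * (((i : ℝ) + 1)⁻¹) ^ (Q + 1))
  convert h1.add h2 using 1
  · funext r
    have hn : (-1 : ℝ) ^ (-((r : ℤ) + 1)) = (-1 : ℝ) ^ ((r : ℤ) + 1) := by
      rw [zpow_neg, ← inv_zpow, inv_neg, inv_one]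
    have hp : (-1 : ℝ) ^ ((r : ℤ) + 1) = (-1) ^ (r + 1) := by exact_mod_cast zpow_natCast (-1 : ℝ) (r + 1)
    rw [kernelTerm, kernelTerm, hn, hp]
    push_cast
    rw [inv_neg, hP.add_one.neg_pow, inv_pow ((r : ℝ) + 1), sub_neg_eq_add]
    ring
  · rw [kernelValue, altHalf.eq_1 _ P Q, Finset.sum_range_succ, symAltZeta.eq_1 (P + 1),
      if_pos hP.add_one, Nat.add_sub_cancel_left, Nat.choose_self,
      show P + Q + 1 - P = Q + 1 by omega]
    push_cast
    ring

theorem hasSum_kernelValue {P Q : ℕ} (hP : 1 ≤ P) :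
    HasSum (fun i : ℕ => kernelValue P Q (i + 1))
      (∑ a ∈ Finset.range P,
          ((P + Q - a).choose Q : ℝ) * symAltZeta (a + 1) * zetaReal (P + Q + 1 - a)
        - ∑ b ∈ Finset.range (Q + 1),
          ((P + Q - b).choose P : ℝ) * symAltZeta (b + 1) * altZetaReal (P + Q + 1 - b)
        - ((P + Q + 1).choose (P + 1) : ℝ) * zetaReal (P + Q + 2)
        + ((P + Q + 1).choose (Q + 1) : ℝ) * altZetaReal (P + Q + 2)) := by
  have h1 := hasSum_sum (s := Finset.range P) fun a ha =>
    (hasSum_inv_pow (s := P + Q + 1 - a) (by have := Finset.mem_range.1 ha; omega)).mul_left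
      (((P + Q - a).choose Q : ℝ) * symAltZeta (a + 1))
  have h2 := hasSum_sum (s := Finset.range (Q + 1)) fun b hb =>
    (hasSum_alt_inv_pow (s := P + Q + 1 - b)
      (by have := Finset.mem_range.1 hb; omega)).mul_left
      (((P + Q - b).choose P : ℝ) * symAltZeta (b + 1))
  have h3 := (hasSum_inv_pow (s := P + Q + 2) (by omega)).mul_left
    ((P + Q + 1).choose (P + 1) : ℝ)
  have h4 := (hasSum_alt_inv_pow (s := P + Q + 2) (by omega)).mul_left
    ((P + Q + 1).choose (Q + 1) : ℝ)
  have h := ((h1.add h2).sub h3).sub h4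
  simp only [mul_neg, Finset.sum_neg_distrib, sub_neg_eq_add, ← sub_eq_add_neg] at h
  refine h.congr_fun fun i => ?_
  rw [kernelValue, altHalf, Finset.mul_sum, add_comm Q P]
  congr 1
  · congr 1
    congr 1
    · exact Finset.sum_congr rfl fun a _ => by ring
    · exact Finset.sum_congr rfl fun a _ => by ring
  · ring

theorem altDoubleZetaReal_eq_sum {P Q : ℕ} (hP : Odd P) (hQ : Even Q) :
    -2 * altDoubleZetaReal (P + 1) (Q + 1) + altZetaReal (P + Q + 2) =
      ∑ a ∈ Finset.range P,
          ((P + Q - a).choose Q : ℝ) * symAltZeta (a + 1) * zetaReal (P + Q + 1 - a)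
        - ∑ b ∈ Finset.range (Q + 1),
          ((P + Q - b).choose P : ℝ) * symAltZeta (b + 1) * altZetaReal (P + Q + 1 - b)
        - ((P + Q + 1).choose (P + 1) : ℝ) * zetaReal (P + Q + 2)
        + ((P + Q + 1).choose (Q + 1) : ℝ) * altZetaReal (P + Q + 2) := by
  have hP1 : 1 ≤ P := hP.pos
  have hp : 2 ≤ P + 1 := by omega
  have hq : 1 ≤ Q + 1 := by omega
  have key : Tendsto (fun K => ∑' r : ℕ, (-1 : ℝ) ^ (r + 1) / ((r : ℝ) + 1) ^ (P + 1) *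
      shiftSum (Q + 1) r K) atTop (𝓝 (∑' r : ℕ, (-1 : ℝ) ^ (r + 1) / ((r : ℝ) + 1) ^ (P + 1) *
        (-realHarmonic (Q + 1) r - realHarmonic (Q + 1) (r + 1)))) := by
    refine tendsto_tsum_of_dominated_convergence
      ((summable_realHarmonic_succ_div hp hq).mul_left 3)
      (fun r => (tendsto_shiftSum hQ.add_one r).const_mul _) (Eventually.of_forall fun K r => ?_)
    rw [norm_mul, norm_div, norm_pow, norm_pow, norm_neg, norm_one, one_pow,
      Real.norm_of_nonneg (by positivity : (0 : ℝ) ≤ (r : ℝ) + 1), Real.norm_eq_abs,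
      ← mul_div_assoc, one_div_mul_eq_div]
    gcongr
    exact abs_shiftSum_le hQ.add_one r K
  have hL : HasSum (fun r : ℕ => (-1 : ℝ) ^ (r + 1) / ((r : ℝ) + 1) ^ (P + 1) *
        (-realHarmonic (Q + 1) r - realHarmonic (Q + 1) (r + 1)))
      (-2 * altDoubleZetaReal (P + 1) (Q + 1) + altZetaReal (P + Q + 2)) := by
    refine (((hasSum_altDoubleZetaReal hp hq).mul_left (-2)).add
      (hasSum_altZetaReal (s := P + Q + 2) (by omega))).congr_fun fun r => ?_
    -- H_r + H_{r+1} = 2 H_r + 1/(r+1)^(Q+1): the last term makes the single alternating zeta value.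
    rw [realHarmonic_succ, show P + Q + 2 = (P + 1) + (Q + 1) by ring, pow_add _ (P + 1)]
    field_simp
    ring
  rw [hL.tsum_eq] at key
  refine tendsto_nhds_unique key ((hasSum_kernelValue hP1).tendsto_sum_nat.congr fun K => ?_)
  refine ((hasSum_sum fun i _ => hasSum_kernel_sub hP Q i).congr_fun fun r => ?_).tsum_eq.symm
  rw [shiftSum, Finset.mul_sum]

/-! ### Parity and the final formula -/

theorem sum_range_odd_of_even_eq_zero (f : ℕ → ℝ) (hf : ∀ l, f (2 * l) = 0) (n : ℕ) :
    ∑ a ∈ Finset.range (2 * n + 1), f a = ∑ l ∈ Finset.range n, f (2 * l + 1) := by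
  induction n with
  | zero => simpa using hf 0
  | succ n ih =>
    rw [Finset.sum_range_succ, Finset.sum_range_succ _ n, ← ih,
      show 2 * (n + 1) = 2 * n + 1 + 1 by ring, Finset.sum_range_succ,
      show 2 * n + 1 + 1 = 2 * (n + 1) by ring, hf, add_zero]

theorem symAltZeta_odd (l : ℕ) : symAltZeta (2 * l + 1) = 0 :=
  if_neg (by simp)

theorem symAltZeta_even (l : ℕ) : symAltZeta (2 * l + 1 + 1) = -2 * altZetaReal (2 * (l + 1)) :=
  if_pos ⟨l + 1, by ring⟩

/-- Only even arguments of `symAltZeta` survive; after division by -2 the two corrections at n = 0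
and n = k become the terms of index 0. -/
theorem altDoubleZetaReal_eq (j m : ℕ) :
    altDoubleZetaReal (2 * (j + 1)) (2 * m + 1) =
      1 / 2 * altZetaReal (2 * m + 2 * (j + 1) + 1)
      - (∑ k ∈ Finset.range m,
          ((2 * (j + 1) + 2 * m - 2 * (k + 1)).choose (2 * (j + 1) - 1) : ℝ) *
            altZetaReal (2 * (k + 1)) * altZetaReal (2 * m + 2 * (j + 1) + 1 - 2 * (k + 1))
        + ((2 * (j + 1) + 2 * m).choose (2 * (j + 1) - 1) : ℝ) * (1 / 2) *
            altZetaReal (2 * m + 2 * (j + 1) + 1))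
      + (∑ l ∈ Finset.range j,
          ((2 * (j + 1) + 2 * m - 2 * (l + 1)).choose (2 * m) : ℝ) *
            altZetaReal (2 * (l + 1)) * zetaReal (2 * m + 2 * (j + 1) + 1 - 2 * (l + 1))
        + ((2 * (j + 1) + 2 * m).choose (2 * m) : ℝ) * (1 / 2) *
            zetaReal (2 * m + 2 * (j + 1) + 1)) := by
  have h := altDoubleZetaReal_eq_sum (P := 2 * j + 1) (Q := 2 * m) ⟨j, rfl⟩ (even_two_mul m)
  rw [sum_range_odd_of_even_eq_zero _ (fun l => by rw [symAltZeta_odd]; ring),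
    sum_range_odd_of_even_eq_zero _ (fun l => by rw [symAltZeta_odd]; ring)] at h
  simp only [symAltZeta_even] at h
  have c1 : (2 * j + 1 + 2 * m + 1).choose (2 * j + 1 + 1)
      = (2 * (j + 1) + 2 * m).choose (2 * m) := by
    rw [show 2 * j + 1 + 2 * m + 1 = 2 * (j + 1) + 2 * m by ring]
    exact Nat.choose_symm_of_eq_add (by ring)
  have c2 : (2 * j + 1 + 2 * m + 1).choose (2 * m + 1)
      = (2 * (j + 1) + 2 * m).choose (2 * (j + 1) - 1) := by
    rw [show 2 * j + 1 + 2 * m + 1 = 2 * (j + 1) + 2 * m by ring]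
    exact Nat.choose_symm_of_eq_add (by omega)
  have e (k : ℕ) : 2 * j + 1 + 2 * m - (2 * k + 1) = 2 * (j + 1) + 2 * m - 2 * (k + 1) := by omega
  have e' (k : ℕ) : 2 * j + 1 + 2 * m + 1 - (2 * k + 1)
      = 2 * m + 2 * (j + 1) + 1 - 2 * (k + 1) := by omega
  have s (n : ℕ) (f g : ℕ → ℝ) (c : ℕ → ℕ) :
      ∑ k ∈ Finset.range n, (c k : ℝ) * (-2 * f k) * g k
        = -2 * ∑ k ∈ Finset.range n, (c k : ℝ) * f k * g k := by
    rw [Finset.mul_sum]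
    exact Finset.sum_congr rfl fun k _ => by ring
  rw [c1, c2] at h
  simp only [e, e'] at h
  rw [s, s, show 2 * j + 1 + 2 * m + 2 = 2 * m + 2 * (j + 1) + 1 by ring,
    show 2 * j + 1 + 1 = 2 * (j + 1) by ring] at h
  rw [show 2 * (j + 1) - 1 = 2 * j + 1 by omega] at h ⊢
  linarith

theorem mainTheorem1 (j m : ℕ) (hj : 1 ≤ j) :
    Summable (altDoubleZetaTerm (2 * j) (2 * m + 1)) ∧
    HasSum (fun n : ℕ =>
        genHarmonic (2 * m + 1) n / ((n : ℂ) + 1) ^ (2 * j) * (-1 : ℂ) ^ (n + 1))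
      (altDoubleZeta (2 * j) (2 * m + 1)) ∧
    altDoubleZeta (2 * j) (2 * m + 1) =
      1 / 2 * altZeta (2 * m + 2 * j + 1)
      - ∑ k ∈ Finset.range (m + 1),
          ((2 * j + 2 * m - 2 * k).choose (2 * j - 1) : ℂ) *
            altZeta (2 * k) * altZeta (2 * m + 2 * j + 1 - 2 * k)
      + ∑ l ∈ Finset.range j,
          ((2 * j + 2 * m - 2 * l).choose (2 * m) : ℂ) *
            altZeta (2 * l) * riemannZeta ((2 * m + 2 * j + 1 - 2 * l : ℕ) : ℂ) := by
  obtain ⟨j, rfl⟩ : ∃ i, j = i + 1 := ⟨j - 1, by omega⟩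
  have hp : 2 ≤ 2 * (j + 1) := by omega
  have hq : 1 ≤ 2 * m + 1 := by omega
  refine ⟨summable_altDoubleZetaTerm hp hq, hasSum_altDoubleZeta hp hq, ?_⟩
  have hz : altZeta 0 = 1 / 2 := if_pos rfl
  rw [altDoubleZeta_eq_ofReal hp hq, altDoubleZetaReal_eq, Finset.sum_range_succ' _ m,
    Finset.sum_range_succ' _ j, mul_zero, Nat.sub_zero, Nat.sub_zero, hz,
    altZeta_eq_ofReal (by omega), riemannZeta_eq_ofReal (by omega)]
  push_cast
  congr 1
  · congr 2
    refine Finset.sum_congr rfl fun k hk => ?_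
    have := Finset.mem_range.1 hk
    rw [altZeta_eq_ofReal (by omega), altZeta_eq_ofReal (by omega)]
  · congr 1
    refine Finset.sum_congr rfl fun l hl => ?_
    have := Finset.mem_range.1 hl
    rw [altZeta_eq_ofReal (by omega), riemannZeta_eq_ofReal (by omega)]
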